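/- A numerical semigroup is a subset $S\subseteq\mathbb N$ containing $0$, closed under addition, with finite complement $\mathbb N\setminus S$. Write $S^*=S\setminus\{0\}$, and let $m(S)=\min S^*$ be the multiplicity, $F(S)=\max(\mathbb Z\setminus S)$ the Frobenius number, $c(S)=F(S)+1$ the conductor, $L(S)=\{a\in S: a<F(S)\}$ and $R(S)=\{a\in S: a>F(S)\}$ the left and right parts, $P(S)=S^*\setminus(S^*+S^*)$ the set of primitive elements, $e(S)=|P(S)|$ the embedding dimension, and $e_l(S)=|P(S)\cap L(S)|$ the number of left primitive elements. For $m\ge 1$ let $O_m=\{0\}\cup(m+\mathbb N)$. A child of $S$ is a numerical semigroup of the form $S\setminus\{a\}$ with $a\in P(S)\cap R(S)$; the tree $\mathcal T$ has all numerical semigroups as vertices, with these parent-child relations. A descendant of $S$ is a numerical semigroup obtained from $S$ by passing to a child finitely many times (possibly zero times, so $S$ is a descendant of itself). A numerical semigroup $T$ satisfies Wilf's conjecture if $e(T)\,|L(T)|\ge c(T)$. Corollary. Let $S$ be a numerical semigroup of multiplicity $m=m(S)$ with $S\ne O_m$ and $e_l(S)\ge m/3$. Then every descendant $T$ of $S$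 in $\mathcal T$ satisfies Wilf's conjecture, i.e. $e(T)\,|L(T)|\ge c(T)$. -/

import Mathlib

/-- A numerical semigroup: a submonoid of `(ℕ, +)` with finite complement. -/
structure NumericalSemigroup extends AddSubmonoid ℕ where
  finite_compl' : {n : ℕ | n ∉ carrier}.Finite

namespace NumericalSemigroup

instance : SetLike NumericalSemigroup ℕ where
  coe S := S.carrier
  coe_injective S T h := by
    obtain ⟨⟨⟨S, _⟩, _⟩, _⟩ := S
    obtain ⟨⟨⟨T, _⟩, _⟩, _⟩ := T
    simp_all

instance : AddSubmonoidClass NumericalSemigroup ℕ where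
  zero_mem S := S.toAddSubmonoid.zero_mem
  add_mem {S} _ _ ha hb := S.toAddSubmonoid.add_mem ha hb

theorem finite_compl (S : NumericalSemigroup) : {n : ℕ | n ∉ S}.Finite :=
  S.finite_compl'

/-- The multiplicity `m(S)`: the least nonzero element of `S`. -/
noncomputable def multiplicity (S : NumericalSemigroup) : ℕ :=
  sInf {a : ℕ | a ∈ S ∧ a ≠ 0}

/-- The Frobenius number `F(S) = max (ℤ \ S)`; it is `-1` for `S = ℕ`. -/
noncomputable def frobenius (S : NumericalSemigroup) : ℤ :=
  sSup {z : ℤ | ∀ a ∈ S, (a : ℤ) ≠ z}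

/-- The conductor `c(S) = F(S) + 1`. -/
noncomputable def conductor (S : NumericalSemigroup) : ℤ :=
  S.frobenius + 1

/-- The set `P(S)` of primitive elements: nonzero elements of `S` that are not the sum of two
nonzero elements of `S`. -/
def primitives (S : NumericalSemigroup) : Set ℕ :=
  {a | a ∈ S ∧ a ≠ 0 ∧ ∀ x ∈ S, ∀ y ∈ S, x ≠ 0 → y ≠ 0 → x + y ≠ a}

/-- The left part `L(S)` of `S`. -/
def leftPart (S : NumericalSemigroup) : Set ℕ :=
  {a | a ∈ S ∧ (a : ℤ) < S.frobenius}

/-- The right part `R(S)` of `S`. -/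
def rightPart (S : NumericalSemigroup) : Set ℕ :=
  {a | a ∈ S ∧ S.frobenius < (a : ℤ)}

/-- The embedding dimension `e(S) = |P|`. -/
noncomputable def embeddingDim (S : NumericalSemigroup) : ℕ :=
  S.primitives.ncard

/-- The number `e_l(S) = |P ∩ L|` of left primitive elements. -/
noncomputable def numLeftPrimitives (S : NumericalSemigroup) : ℕ :=
  (S.primitives ∩ S.leftPart).ncard

/-- The ordinary numerical semigroup `O_m = {0} ∪ (m + ℕ)` (of interest for `m ≥ 1`). -/
def ordinary (m : ℕ) : NumericalSemigroup where
  carrier := {n | n = 0 ∨ m ≤ n}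
  zero_mem' := Or.inl rfl
  add_mem' := by
    intro a b ha hb
    simp only [Set.mem_ofPred] at *
    omega
  finite_compl' := (Set.finite_lt_nat m).subset (by
    intro n hn
    simp only [Set.mem_ofPred] at *
    omega)

/-- `S'` is a child of `S` in the tree of numerical semigroups: it is obtained from `S` by removing
one right primitive element. -/
def IsChild (S' S : NumericalSemigroup) : Prop :=
  ∃ a ∈ S.primitives ∩ S.rightPart, (S' : Set ℕ) = (S : Set ℕ) \ {a}

/-- `T` is a descendant of `S`: it is reached from `S` by finitely many (possibly zero) steps, each
from a semigroup to one of its children. -/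
def IsDescendant (T S : NumericalSemigroup) : Prop :=
  Relation.ReflTransGen (fun A B : NumericalSemigroup => B.IsChild A) S T

/-- `S` satisfies Wilf's conjecture: `e |L| ≥ c`. -/
def SatisfiesWilf (S : NumericalSemigroup) : Prop :=
  S.conductor ≤ (S.embeddingDim : ℤ) * (S.leftPart.ncard : ℤ)

/-! Well-definedness: the extremal elements above exist and the cardinalities are finite. -/

theorem exists_bound (S : NumericalSemigroup) : ∃ N : ℕ, ∀ n : ℕ, N ≤ n → n ∈ S := by
  obtain ⟨N, hN⟩ := S.finite_compl.bddAbove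
  refine ⟨N + 1, fun n hn => ?_⟩
  by_contra h
  have := hN h
  omega

theorem multiplicity_isLeast (S : NumericalSemigroup) :
    IsLeast {a : ℕ | a ∈ S ∧ a ≠ 0} S.multiplicity := by
  obtain ⟨N, hN⟩ := S.exists_bound
  have hne : {a : ℕ | a ∈ S ∧ a ≠ 0}.Nonempty := ⟨N + 1, hN _ (by omega), by omega⟩
  exact ⟨Nat.sInf_mem hne, fun a ha => Nat.sInf_le ha⟩

theorem frobenius_isGreatest (S : NumericalSemigroup) :
    IsGreatest {z : ℤ | ∀ a ∈ S, (a : ℤ) ≠ z} S.frobenius := by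
  obtain ⟨N, hN⟩ := S.exists_bound
  have hne : {z : ℤ | ∀ a ∈ S, (a : ℤ) ≠ z}.Nonempty := ⟨-1, fun a _ => by omega⟩
  have hb : BddAbove {z : ℤ | ∀ a ∈ S, (a : ℤ) ≠ z} := by
    refine ⟨N, fun z hz => ?_⟩
    by_contra h
    exact hz z.toNat (hN _ (by omega)) (by omega)
  exact ⟨Int.csSup_mem hne hb, fun z hz => le_csSup hb hz⟩

theorem leftPart_finite (S : NumericalSemigroup) : S.leftPart.Finite :=
  (Set.finite_lt_nat S.frobenius.toNat).subset (by
    intro a ha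
    have := ha.2
    simp only [Set.mem_ofPred]
    omega)

theorem primitives_finite (S : NumericalSemigroup) : S.primitives.Finite := by
  obtain ⟨N, hN⟩ := S.exists_bound
  refine (Set.finite_lt_nat (2 * N + 2)).subset fun a ha => ?_
  by_contra h
  simp only [Set.mem_ofPred, not_lt] at h
  exact ha.2.2 (N + 1) (hN _ (by omega)) (a - (N + 1)) (hN _ (by omega)) (by omega) (by omega)
    (by omega)

end NumericalSemigroup

/-! Removing a right primitive keeps the left primitives, and keeps the multiplicity m once some
left primitive exists. So `m ≤ 3 * e_l` passes to descendants, and it suffices to prove Wilf's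
inequality from it (`satisfiesWilf_of_le`).

Let c be the conductor, q = ⌈c/m⌉ and ρ = qm - c. The Apéry set of m consists of 0, the primitives
other than m, and the decomposable elements D, so m = e + |D|. Let δ(x) be the number of x + jm
below c, X the nonzero Apéry elements below c, and Λ the sum of δ over X. Then |L| = q + Λ, and
Wilf's inequality becomes q|D| ≤ eΛ + ρ. If x + y = z lies in D, then δ(x) + δ(y) ≥ q + δ(z) - ε(z),
where ε is 0 or 1 and sums to at most ρ over D. With P the small primitives and r the number of
large ones, e = |P| + 1 + r, and the hypothesis reads |D| + r ≤ 2|P| + 2.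

If every element of D is a sum of two elements of P, degree counting suffices (`le_of_pairs`).
Otherwise X meets D, which forces q ≥ 3. For e ≥ 4, a large D contains sums avoiding any few chosen
elements; this bounds the largest depths, hence Λ, from below (`le_of_card_bounds`). For e ≤ 3 there
are at most e - 1 maximal Apéry elements, and `le_mul_card_of_maxApery` concludes. -/

/-! ### Weighted sums of small Apéry elements. -/

/-- Data extracted from the Apéry set of a numerical semigroup: `P` are the small primitive
elements, `D` the decomposable elements, `X` the small elements, `δ` the depth, and `ε` a
correction term. -/
structure SumGraph (P D X : Finset ℕ) (δ ε : ℕ → ℕ) (q ρ : ℕ) : Prop where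
  sub : P ⊆ X
  dec : ∀ x ∈ X, x ∉ P → x ∈ D
  pos : ∀ x ∈ X, 0 < x
  prim : ∀ x ∈ X, ∀ y ∈ X, x + y ∉ P
  split : ∀ z ∈ D, ∃ x ∈ X, ∃ y ∈ X, x + y = z
  -- Rounding in the depths costs at most one, which `ε` records; `eps_sum` bounds the total cost by
  -- `ρ`.
  wt : ∀ x ∈ X, ∀ y ∈ X, x + y ∈ D → q + δ (x + y) ≤ δ x + δ y + ε (x + y)
  closed : ∀ x ∈ X, ∀ y ∈ X, ∀ w ∈ X, x + y + w ∈ D → x + y ∈ X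
  one : ∀ x ∈ X, 1 ≤ δ x
  eps : ∀ z, ε z ≤ 1
  eps_sum : ∑ z ∈ D, ε z ≤ ρ

namespace SumGraph

variable {P D X : Finset ℕ} {δ ε : ℕ → ℕ} {q ρ : ℕ}

theorem wt' (h : SumGraph P D X δ ε q ρ) {x y : ℕ} (hx : x ∈ X) (hy : y ∈ X) (hz : x + y ∈ D) :
    q ≤ δ x + δ y + 1 := by
  have := h.wt x hx y hy hz
  have := h.eps (x + y)
  omega

/-- If all decomposable elements are sums of two primitive ones, count degrees. -/
theorem le_of_pairs (h : SumGraph P D X δ ε q ρ)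
    (hD : ∀ z ∈ D, ∃ x ∈ P, ∃ y ∈ P, x + y = z) :
    q * D.card ≤ (P.card + 1) * ∑ x ∈ X, δ x + ρ := by
  have hD' : ∀ z ∈ D, ∃ x ∈ P, ∃ y ∈ P, x ≤ y ∧ x + y = z := by
    intro z hz
    obtain ⟨x, hx, y, hy, e⟩ := hD z hz
    rcases le_total x y with hxy | hxy
    · exact ⟨x, hx, y, hy, hxy, e⟩
    · exact ⟨y, hy, x, hx, hxy, by omega⟩
  choose! f hf g hg hfg hsum using hD'
  have h1 : q * D.card ≤ ∑ z ∈ D, (δ (f z) + δ (g z) + ε z) := by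
    rw [mul_comm, ← smul_eq_mul]
    refine Finset.card_nsmul_le_sum _ _ _ fun z hz => ?_
    have := h.wt (f z) (h.sub (hf z hz)) (g z) (h.sub (hg z hz)) (by rw [hsum z hz]; exact hz)
    rw [hsum z hz] at this
    omega
  have h2 : ∑ z ∈ D, δ (f z) = ∑ p ∈ P, (D.filter (fun z => f z = p)).card * δ p := by
    rw [← Finset.sum_fiberwise_of_maps_to hf]
    refine Finset.sum_congr rfl fun p _ => ?_
    rw [← smul_eq_mul, ← Finset.sum_const]
    refine Finset.sum_congr rfl fun z hz => ?_
    rw [(Finset.mem_filter.1 hz).2]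
  have h3 : ∑ z ∈ D, δ (g z) = ∑ p ∈ P, (D.filter (fun z => g z = p)).card * δ p := by
    rw [← Finset.sum_fiberwise_of_maps_to hg]
    refine Finset.sum_congr rfl fun p _ => ?_
    rw [← smul_eq_mul, ← Finset.sum_const]
    refine Finset.sum_congr rfl fun z hz => ?_
    rw [(Finset.mem_filter.1 hz).2]
  -- The other summand is at least `p` in the first fibre and at most `p` in the second; these
  -- ranges share only `p`, the loop `p + p`.
  have h4 : ∀ p ∈ P, (D.filter (fun z => f z = p)).card + (D.filter (fun z => g z = p)).card
      ≤ P.card + 1 := by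
    intro p hp
    have a1 : (D.filter (fun z => f z = p)).card ≤ (P.filter (fun y => p ≤ y)).card := by
      refine Finset.card_le_card_of_injOn g ?_ ?_
      · intro z hz
        simp only [Finset.coe_filter, Set.mem_ofPred] at hz ⊢
        exact ⟨hg z hz.1, hz.2 ▸ hfg z hz.1⟩
      · intro z hz w hw e
        simp only [Finset.coe_filter, Set.mem_ofPred] at hz hw
        rw [← hsum z hz.1, ← hsum w hw.1, hz.2, hw.2, e]
    have a2 : (D.filter (fun z => g z = p)).card ≤ (P.filter (fun y => y ≤ p)).card := by
      refine Finset.card_le_card_of_injOn f ?_ ?_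
      · intro z hz
        simp only [Finset.coe_filter, Set.mem_ofPred] at hz ⊢
        exact ⟨hf z hz.1, hz.2 ▸ hfg z hz.1⟩
      · intro z hz w hw e
        simp only [Finset.coe_filter, Set.mem_ofPred] at hz hw
        rw [← hsum z hz.1, ← hsum w hw.1, hz.2, hw.2, e]
    have a3 := Finset.card_union_add_card_inter (P.filter (fun y => p ≤ y))
      (P.filter (fun y => y ≤ p))
    have a4 : (P.filter (fun y => p ≤ y) ∪ P.filter (fun y => y ≤ p)).card ≤ P.card :=
      Finset.card_le_card (Finset.union_subset (Finset.filter_subset _ _)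
        (Finset.filter_subset _ _))
    have a5 : (P.filter (fun y => p ≤ y) ∩ P.filter (fun y => y ≤ p)).card ≤ 1 := by
      rw [Finset.card_le_one]
      intro a ha b hb
      simp only [Finset.mem_inter, Finset.mem_filter] at ha hb
      omega
    omega
  have h5 : ∑ z ∈ D, δ (f z) + ∑ z ∈ D, δ (g z) ≤ (P.card + 1) * ∑ p ∈ P, δ p := by
    rw [h2, h3, ← Finset.sum_add_distrib, Finset.mul_sum]
    refine Finset.sum_le_sum fun p hp => ?_
    rw [← add_mul]
    exact Nat.mul_le_mul_right _ (h4 p hp)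
  have h6 : ∑ p ∈ P, δ p ≤ ∑ x ∈ X, δ x := Finset.sum_le_sum_of_subset h.sub
  have h7 := Nat.mul_le_mul_left (P.card + 1) h6
  have h8 := h.eps_sum
  rw [Finset.sum_add_distrib, Finset.sum_add_distrib] at h1
  omega

/-- Outside `{3 x} ∪ (x + P)`, decomposable elements are sums of two small elements other than `x`. -/
theorem exists_pair_avoiding (h : SumGraph P D X δ ε q ρ) {x : ℕ} (hx : x ∈ X) {z : ℕ}
    (hz : z ∈ D) (hzx : z ∉ insert (3 * x) (P.image (x + ·))) :
    ∃ u ∈ X, ∃ v ∈ X, u ≠ x ∧ v ≠ x ∧ u + v = z := by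
  simp only [Finset.mem_insert, Finset.mem_image, not_or, not_exists, not_and] at hzx
  obtain ⟨h3, hp⟩ := hzx
  have key : ∀ y ∈ X, x + y = z → ∃ u ∈ X, ∃ v ∈ X, u ≠ x ∧ v ≠ x ∧ u + v = z := by
    intro y hy e
    have hyD : y ∈ D := h.dec y hy fun hP => hp y hP e
    obtain ⟨a, ha, b, hb, rfl⟩ := h.split y hyD
    have hpa := h.pos a ha
    have hpb := h.pos b hb
    have m1 : x + a ∈ X := h.closed x hx a ha b hb (by rw [add_assoc, e]; exact hz)
    have m2 : x + b ∈ X := h.closed x hx b hb a ha (by rw [add_assoc, add_comm b, e]; exact hz)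
    -- Now `z = x + a + b`: regroup as `(x + a) + b` or `(x + b) + a`. Both fail only when `z = 3 *
    -- x`.
    by_cases hbx : b = x
    · by_cases hax : a = x
      · omega
      · exact ⟨x + b, m2, a, ha, by omega, hax, by omega⟩
    · exact ⟨x + a, m1, b, hb, by omega, hbx, by omega⟩
  obtain ⟨u, hu, v, hv, e⟩ := h.split z hz
  by_cases hux : u = x
  · exact key v hv (by omega)
  · by_cases hvx : v = x
    · exact key u hu (by omega)
    · exact ⟨u, hu, v, hv, hux, hvx, e⟩

theorem card_le_card_sdiff_add (P D : Finset ℕ) (x : ℕ) :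
    D.card ≤ (D \ insert (3 * x) (P.image (x + ·))).card + (P.card + 1) := by
  have h1 := Finset.le_card_sdiff (insert (3 * x) (P.image (x + ·))) D
  have h2 := Finset.card_insert_le (3 * x) (P.image (x + ·))
  have h3 : (P.image (x + ·)).card ≤ P.card := Finset.card_image_le
  omega

theorem exists_avoiding (h : SumGraph P D X δ ε q ρ) {x : ℕ} (hx : x ∈ X)
    (hd : P.card + 2 ≤ D.card) :
    ∃ u ∈ X, ∃ v ∈ X, u ≠ x ∧ v ≠ x ∧ u + v ∈ D := by
  have h1 := card_le_card_sdiff_add P D x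
  have h2 : 0 < (D \ insert (3 * x) (P.image (x + ·))).card := by omega
  obtain ⟨z, hz⟩ := Finset.card_pos.1 h2
  rw [Finset.mem_sdiff] at hz
  obtain ⟨u, hu, v, hv, a, b, c⟩ := h.exists_pair_avoiding hx hz.1 hz.2
  exact ⟨u, hu, v, hv, a, b, c ▸ hz.1⟩

theorem exists_ne_avoiding (h : SumGraph P D X δ ε q ρ) {x : ℕ} (hx : x ∈ X)
    (hd : P.card + 3 ≤ D.card) :
    ∃ u ∈ X, ∃ v ∈ X, u ≠ x ∧ v ≠ x ∧ u ≠ v ∧ q ≤ δ u + δ v + 1 := by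
  have h1 := card_le_card_sdiff_add P D x
  have h2 : 1 < (D \ insert (3 * x) (P.image (x + ·))).card := by omega
  obtain ⟨z, hz, w, hw, hzw⟩ := Finset.one_lt_card.1 h2
  rw [Finset.mem_sdiff] at hz hw
  obtain ⟨u, hu, v, hv, a, b, c⟩ := h.exists_pair_avoiding hx hz.1 hz.2
  obtain ⟨u', hu', v', hv', a', b', c'⟩ := h.exists_pair_avoiding hx hw.1 hw.2
  have e1 := h.wt' hu hv (c ▸ hz.1)
  have e2 := h.wt' hu' hv' (c' ▸ hw.1)
  by_cases huv : u = v
  · by_cases huv' : u' = v'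
    -- Two distinct doubles: averaging their inequalities gives one for the pair `u`, `u'`.
    · refine ⟨u, hu, u', hu', a, a', by omega, ?_⟩
      subst huv huv'
      omega
    · exact ⟨u', hu', v', hv', a', b', huv', e2⟩
  · exact ⟨u, hu, v, hv, a, b, huv, e1⟩

/-- If `B ⊆ X` is too small to carry all of `D`, some sum leaves `B`. -/
theorem exists_outside (h : SumGraph P D X δ ε q ρ) (B : Finset ℕ) (K : Finset ℕ)
    (hK : ∀ u ∈ B, ∀ v ∈ B, u + v ∈ K) (hd : K.card < D.card) :
    ∃ u ∈ X, ∃ v ∈ X, u ∉ B ∧ u + v ∈ D := by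
  obtain ⟨z, hz, hzK⟩ := Finset.exists_mem_notMem_of_card_lt_card hd
  obtain ⟨u, hu, v, hv, rfl⟩ := h.split z hz
  by_cases huB : u ∈ B
  · by_cases hvB : v ∈ B
    · exact absurd (hK u huB v hvB) hzK
    · exact ⟨v, hv, u, hu, hvB, add_comm u v ▸ hz⟩
  · exact ⟨u, hu, v, hv, huB, hz⟩

/-- Every element outside `B` still contributes depth at least one. -/
theorem card_sdiff_add_sum_le (h : SumGraph P D X δ ε q ρ) {B : Finset ℕ} (hB : B ⊆ X) :
    ∑ x ∈ B, δ x + X.card ≤ ∑ x ∈ X, δ x + B.card := by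
  rw [← Finset.sum_sdiff hB]
  have h1 : (X \ B).card • 1 ≤ ∑ x ∈ X \ B, δ x :=
    Finset.card_nsmul_le_sum _ _ _ fun x hx => h.one x (Finset.mem_sdiff.1 hx).1
  have h2 := Finset.card_sdiff_add_card_eq_card hB
  simp only [smul_eq_mul, mul_one] at h1
  omega

/-- The case of at most `e` decomposable elements. -/
theorem le_of_card_le (h : SumGraph P D X δ ε q ρ) (hq : 3 ≤ q) {g : ℕ} (hgX : g ∈ X)
    (hgD : g ∈ D) {e : ℕ} (he : 4 ≤ e) (hd : D.card ≤ e) (hX : X.card ≤ 2 → D.card ≤ 2) :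
    q * D.card ≤ e * ∑ x ∈ X, δ x + ρ := by
  set Λ := ∑ x ∈ X, δ x with hΛ
  -- As `δ g ≥ 1`, the sum `g = a + b` gives `δ a + δ b ≥ q`, which settles `a ≠ b`. If `a = b`, a
  -- second element of `D` supplies the missing depth.
  have main : q ≤ Λ ∨ (D.card ≤ 2 ∧ q ≤ Λ + 1) ∨ (D.card ≤ 1 ∧ q ≤ 2 * Λ) := by
    obtain ⟨a, ha, b, hb, hab⟩ := h.split g hgD
    have hpa := h.pos a ha
    have hpb := h.pos b hb
    have w1 := h.wt a ha b hb (hab ▸ hgD)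
    have w2 := h.one g hgX
    have w3 := h.eps (a + b)
    rw [hab] at w1 w3
    by_cases hne : a = b
    · subst hne
      have s1 := h.card_sdiff_add_sum_le (B := {a, g}) (by simp [Finset.insert_subset_iff, ha, hgX])
      rw [Finset.sum_pair (by omega), Finset.card_pair (by omega)] at s1
      have s2 : 2 ≤ X.card := by
        rw [← Finset.card_pair (show a ≠ g by omega)]
        exact Finset.card_le_card (by simp [Finset.insert_subset_iff, ha, hgX])
      by_cases hd1 : D.card ≤ 1
      · right; right; omega
      · obtain ⟨z, hz, hzg⟩ := Finset.exists_mem_ne (by omega : 1 < D.card) g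
        obtain ⟨u, hu, v, hv, rfl⟩ := h.split z hz
        have w4 := h.wt' hu hv hz
        by_cases huv : u = v
        · subst huv
          have s3 := h.card_sdiff_add_sum_le (B := {a, u})
            (by simp [Finset.insert_subset_iff, ha, hu])
          rw [Finset.sum_pair (by omega), Finset.card_pair (by omega)] at s3
          left; omega
        · have s3 := h.card_sdiff_add_sum_le (B := {u, v})
            (by simp [Finset.insert_subset_iff, hu, hv])
          rw [Finset.sum_pair huv, Finset.card_pair huv] at s3
          by_cases hX2 : X.card ≤ 2
          · right; left; exact ⟨hX hX2, by omega⟩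
          · left; omega
    · have s1 := h.card_sdiff_add_sum_le (B := {a, b}) (by simp [Finset.insert_subset_iff, ha, hb])
      rw [Finset.sum_pair hne, Finset.card_pair hne] at s1
      have s2 : ({a, b, g} : Finset ℕ).card ≤ X.card :=
        Finset.card_le_card (by simp [Finset.insert_subset_iff, ha, hb, hgX])
      rw [Finset.card_eq_three.2 ⟨a, b, g, hne, by omega, by omega, rfl⟩] at s2
      left; omega
  rcases main with h1 | ⟨h1, h2⟩ | ⟨h1, h2⟩
  · have := Nat.mul_le_mul hd h1
    rw [mul_comm q]
    omega
  · have := Nat.mul_le_mul_left q h1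
    have := Nat.mul_le_mul_right Λ he
    omega
  · have := Nat.mul_le_mul_left q h1
    have := Nat.mul_le_mul_right Λ he
    omega

set_option maxHeartbeats 400000 in
/-- Three small primitive elements and one small decomposable element. -/
theorem le_of_card_eq_four (h : SumGraph P D X δ ε q ρ) {g : ℕ} (hgX : g ∈ X)
    (hgD : g ∈ D) {e : ℕ} (he : 4 ≤ e) (hX : X.card = 4) (hP : P.card = 3) (hd : 6 ≤ D.card) :
    q * D.card ≤ e * ∑ x ∈ X, δ x + ρ := by
  suffices hs : q * D.card ≤ 4 * ∑ x ∈ X, δ x + ρ by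
    have := Nat.mul_le_mul_right (∑ x ∈ X, δ x) he
    omega
  by_cases hpairs : ∀ z ∈ D, ∃ x ∈ P, ∃ y ∈ P, x + y = z
  · have := h.le_of_pairs hpairs
    rwa [hP] at this
  push Not at hpairs
  obtain ⟨t, ht, htP⟩ := hpairs
  have hgP : g ∉ P := by
    obtain ⟨a, ha, b, hb, rfl⟩ := h.split g hgD
    exact h.prim a ha b hb
  have hXP : X = insert g P := by
    symm
    refine Finset.eq_of_subset_of_card_le (Finset.insert_subset hgX h.sub) ?_
    rw [Finset.card_insert_of_notMem hgP]
    omega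
  -- If `x + g ∈ D` and `g = a + b`, then `x + a` and `x + b` are nonprimitive elements of `X`, so
  -- both equal `g`, whence `x = a = b`.
  have cube : ∀ z ∈ D, (∃ x ∈ P, ∃ y ∈ P, x + y = z) ∨ ∃ a ∈ P, g = 2 * a ∧ z = 3 * a := by
    intro z hz
    have key : ∀ x ∈ X, x + g = z → ∃ a ∈ P, g = 2 * a ∧ z = 3 * a := by
      intro x hx e
      obtain ⟨a, ha, b, hb, hab⟩ := h.split g hgD
      have hpa := h.pos a ha
      have hpb := h.pos b hb
      have hpx := h.pos x hx
      have m1 : x + a ∈ X := h.closed x hx a ha b hb (by rw [add_assoc, hab, e]; exact hz)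
      have m2 : x + b ∈ X :=
        h.closed x hx b hb a ha (by rw [add_assoc, add_comm b, hab, e]; exact hz)
      have m3 : ∀ u ∈ X, ∀ v ∈ X, u + v ∈ X → u + v = g := by
        intro u hu v hv huv
        rw [hXP, Finset.mem_insert] at huv
        exact huv.resolve_right (h.prim u hu v hv)
      have e1 := m3 x hx a ha m1
      have e2 := m3 x hx b hb m2
      rw [hXP, Finset.mem_insert] at ha
      exact ⟨a, ha.resolve_left (by omega), by omega, by omega⟩
    obtain ⟨u, hu, v, hv, e⟩ := h.split z hz
    by_cases hug : u = g
    · exact Or.inr (key v hv (by omega))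
    · by_cases hvg : v = g
      · exact Or.inr (key u hu (by omega))
      · rw [hXP, Finset.mem_insert] at hu hv
        exact Or.inl ⟨u, hu.resolve_left hug, v, hv.resolve_left hvg, e⟩
  obtain ⟨a, ha, hga, hta⟩ := (cube t ht).resolve_left (by
    rintro ⟨x, hx, y, hy, e⟩
    exact htP x hx y hy e)
  obtain ⟨y, u, hyu, hPa⟩ : ∃ y u, y ≠ u ∧ P.erase a = {y, u} := by
    rw [← Finset.card_eq_two, Finset.card_erase_of_mem ha, hP]
  have hP' : P = {a, y, u} := by rw [← Finset.insert_erase ha, hPa]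
  have hy : y ∈ P := by simp [hP']
  have hu : u ∈ P := by simp [hP']
  have hay : a ≠ y := by
    have : y ∈ P.erase a := by simp [hPa]
    exact (Finset.ne_of_mem_erase this).symm
  have hau : a ≠ u := by
    have : u ∈ P.erase a := by simp [hPa]
    exact (Finset.ne_of_mem_erase this).symm
  have hpa := h.pos a (h.sub ha)
  have hΛ : ∑ x ∈ X, δ x = δ g + δ a + δ y + δ u := by
    rw [hXP, Finset.sum_insert hgP, hP', Finset.sum_insert (by simp [hay, hau]),
      Finset.sum_pair hyu]
    ring
  have hDsub : ∀ z ∈ D, z = 3 * a ∨ z = 2 * a ∨ z = a + y ∨ z = a + u ∨ z = 2 * y ∨ z = 2 * u ∨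
      z = y + u := by
    intro z hz
    rcases cube z hz with ⟨b, hb, b', hb', rfl⟩ | ⟨b, -, h1, h2⟩
    · rw [hP'] at hb hb'
      simp only [Finset.mem_insert, Finset.mem_singleton] at hb hb'
      omega
    · omega
  have hg1 := h.one g hgX
  have w1 := h.wt a (h.sub ha) a (h.sub ha) (by rw [← two_mul, ← hga]; exact hgD)
  rw [← two_mul, ← hga] at w1
  have e1 := h.eps g
  have w2 := h.wt a (h.sub ha) g hgX (by rw [hga]; convert ht using 1; omega)
  have e2 := h.eps (a + g)
  have wyu : y + u ∈ D → q ≤ δ y + δ u + ε (y + u) := fun hm => by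
    have := h.wt y (h.sub hy) u (h.sub hu) hm
    omega
  have wyy : 2 * y ∈ D → q ≤ 2 * δ y + ε (2 * y) := fun hm => by
    have := h.wt y (h.sub hy) y (h.sub hy) (by rwa [← two_mul])
    rw [← two_mul] at this
    omega
  have wuu : 2 * u ∈ D → q ≤ 2 * δ u + ε (2 * u) := fun hm => by
    have := h.wt u (h.sub hu) u (h.sub hu) (by rwa [← two_mul])
    rw [← two_mul] at this
    omega
  have eyu := h.eps (y + u)
  have eyy := h.eps (2 * y)
  have euu := h.eps (2 * u)
  have hd7 : D.card ≤ 7 := by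
    have hsub : D ⊆ {3 * a, 2 * a, a + y, a + u, 2 * y, 2 * u, y + u} := by
      intro z hz
      simpa using hDsub z hz
    have h1 := Finset.card_le_card hsub
    have h2 := Finset.card_insert_le (3 * a) {2 * a, a + y, a + u, 2 * y, 2 * u, y + u}
    have h3 : ({2 * a, a + y, a + u, 2 * y, 2 * u, y + u} : Finset ℕ).card ≤ 6 :=
      Finset.card_le_six
    omega
  rw [hΛ]
  -- `D` lies in a list of seven sums: either all occur and are distinct, or at most one is missing.
  by_cases h7 : D.card = 7
  · have all : ∀ w, (w = 2 * y ∨ w = 2 * u ∨ w = y + u) → w ∈ D := by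
      have six : ∀ b₁ b₂ b₃ b₄ b₅ b₆ : ℕ, ¬ D ⊆ {b₁, b₂, b₃, b₄, b₅, b₆} := by
        intro b₁ b₂ b₃ b₄ b₅ b₆ hsub
        have h1 := (Finset.card_le_card hsub).trans Finset.card_le_six
        omega
      intro w hw
      by_contra hwD
      rcases hw with rfl | rfl | rfl
      · refine six (3 * a) (2 * a) (a + y) (a + u) (2 * u) (y + u) fun z hz => ?_
        have h2 := ne_of_mem_of_not_mem hz hwD
        rcases hDsub z hz with e | e | e | e | e | e | e <;>
          first | exact absurd e h2 | (rw [e]; simp)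
      · refine six (3 * a) (2 * a) (a + y) (a + u) (2 * y) (y + u) fun z hz => ?_
        have h2 := ne_of_mem_of_not_mem hz hwD
        rcases hDsub z hz with e | e | e | e | e | e | e <;>
          first | exact absurd e h2 | (rw [e]; simp)
      · refine six (3 * a) (2 * a) (a + y) (a + u) (2 * y) (2 * u) fun z hz => ?_
        have h2 := ne_of_mem_of_not_mem hz hwD
        rcases hDsub z hz with e | e | e | e | e | e | e <;>
          first | exact absurd e h2 | (rw [e]; simp)
    have n1 := htP y hy y hy
    have n2 := htP u hu u hu
    have n3 := htP y hy u hu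
    have es : ∑ z ∈ ({a + g, 2 * y, 2 * u, y + u} : Finset ℕ), ε z ≤ ρ := by
      refine (Finset.sum_le_sum_of_subset ?_).trans h.eps_sum
      have : a + g ∈ D := by convert ht using 1; omega
      simp [Finset.insert_subset_iff, this, all]
    rw [Finset.sum_insert (by simp; omega), Finset.sum_insert (by simp; omega),
      Finset.sum_pair (by omega)] at es
    have := wyu (all _ (by simp))
    have := wyy (all _ (by simp))
    have := wuu (all _ (by simp))
    rw [h7]
    omega
  · have h6 : D.card = 6 := by omega
    have hyu' : q ≤ δ y + δ u + 1 := by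
      by_cases m1 : y + u ∈ D
      · have := wyu m1
        omega
      have five : ∀ b₁ b₂ b₃ b₄ b₅ : ℕ, ¬ D ⊆ {b₁, b₂, b₃, b₄, b₅} := by
        intro b₁ b₂ b₃ b₄ b₅ hsub
        have h1 := (Finset.card_le_card hsub).trans Finset.card_le_five
        omega
      have none_missing : ∀ w, (w = 2 * y ∨ w = 2 * u) → w ∈ D := by
        intro w hw
        by_contra hwD
        rcases hw with rfl | rfl
        · refine five (3 * a) (2 * a) (a + y) (a + u) (2 * u) fun z hz => ?_
          have h2 := ne_of_mem_of_not_mem hz hwD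
          have h3 := ne_of_mem_of_not_mem hz m1
          rcases hDsub z hz with e | e | e | e | e | e | e <;>
            first | exact absurd e h2 | exact absurd e h3 | (rw [e]; simp)
        · refine five (3 * a) (2 * a) (a + y) (a + u) (2 * y) fun z hz => ?_
          have h2 := ne_of_mem_of_not_mem hz hwD
          have h3 := ne_of_mem_of_not_mem hz m1
          rcases hDsub z hz with e | e | e | e | e | e | e <;>
            first | exact absurd e h2 | exact absurd e h3 | (rw [e]; simp)
      have := wyy (none_missing _ (by simp))
      have := wuu (none_missing _ (by simp))
      omega
    rw [h6]
    omega

end SumGraph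

namespace SumGraph

variable {P D X : Finset ℕ} {δ ε : ℕ → ℕ} {q ρ : ℕ}

/-- With five small elements of total depth `2 q - 1`, at most four sums have no correction. -/
theorem card_le_sum_eps_add_four (h : SumGraph P D X δ ε q ρ) {b₁ b₂ b₃ : ℕ} {k : ℕ}
    (h12 : δ b₂ ≤ δ b₁) (h23 : δ b₃ ≤ δ b₂)
    (hk : ∀ x ∈ X, x ∉ ({b₁, b₂, b₃} : Finset ℕ) → δ x ≤ k)
    (hb₁ : ∀ x ∈ X, δ x ≤ δ b₁) (h14 : δ b₁ + k < q) (h23q : δ b₂ + δ b₃ < q) :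
    D.card ≤ ∑ z ∈ D, ε z + 4 := by
  -- Without correction the two depths add up to at least `q`; `h14` and `h23q` leave only these
  -- four sums.
  have h1 : (D.filter (fun z => ε z = 0)).card ≤ 4 := by
    refine (Finset.card_le_card (t := {b₁ + b₁, b₁ + b₂, b₁ + b₃, b₂ + b₂}) ?_).trans
      Finset.card_le_four
    intro z hz
    rw [Finset.mem_filter] at hz
    obtain ⟨u, hu, v, hv, rfl⟩ := h.split z hz.1
    have hw := h.wt u hu v hv hz.1
    rw [hz.2] at hw
    have key : ∀ x ∈ X, ∀ y ∈ X, q ≤ δ x + δ y → x ∈ ({b₁, b₂, b₃} : Finset ℕ) := by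
      intro x hx y hy hxy
      by_contra hxb
      have := hk x hx hxb
      have := hb₁ y hy
      omega
    have ku := key u hu v hv (by omega)
    have kv := key v hv u hu (by omega)
    simp only [Finset.mem_insert, Finset.mem_singleton] at ku kv ⊢
    rcases ku with rfl | rfl | rfl <;> rcases kv with rfl | rfl | rfl <;> omega
  have h2 : D.card ≤ ∑ z ∈ D, (ε z + if ε z = 0 then 1 else 0) := by
    rw [Finset.card_eq_sum_ones]
    refine Finset.sum_le_sum fun z _ => ?_
    split_ifs <;> omega
  rw [Finset.sum_add_distrib, ← Finset.card_filter] at h2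
  omega

/-- With `b₁`, `b₂`, … of largest depth, each lower bound on `D.card` yields a sum avoiding some of
them, hence an inequality such as `q ≤ δ b₂ + δ b₃ + 1`. Adding these makes `Λ` about `3q/2`, or
`2q` once `D` has at least seven elements, where `D.card ≤ 2 * e`. -/
theorem le_of_card_bounds (h : SumGraph P D X δ ε q ρ) (hq : 3 ≤ q) {g : ℕ} (hgX : g ∈ X)
    (hgD : g ∈ D) {e r : ℕ} (her : e = P.card + 1 + r) (he : 4 ≤ e)
    (hd : D.card + r ≤ 2 * P.card + 2) :
    q * D.card ≤ e * ∑ x ∈ X, δ x + ρ := by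
  have hgP : g ∉ P := by
    obtain ⟨a, ha, b, hb, rfl⟩ := h.split g hgD
    exact h.prim a ha b hb
  have hXP : P.card + 1 ≤ X.card := by
    rw [← Finset.card_insert_of_notMem hgP]
    exact Finset.card_le_card (Finset.insert_subset hgX h.sub)
  by_cases hde : D.card ≤ e
  · exact h.le_of_card_le hq hgX hgD he hde fun _ => by omega
  obtain ⟨b₁, hb₁, max₁⟩ := Finset.exists_max_image X δ ⟨g, hgX⟩
  obtain ⟨b₂, hb₂, max₂⟩ := Finset.exists_max_image (X.erase b₁) δ (by
    rw [← Finset.card_pos, Finset.card_erase_of_mem hb₁]; omega)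
  have c2 : ((X.erase b₁).erase b₂).card = X.card - 2 := by
    rw [Finset.card_erase_of_mem hb₂, Finset.card_erase_of_mem hb₁]; omega
  obtain ⟨b₃, hb₃, max₃⟩ := Finset.exists_max_image ((X.erase b₁).erase b₂) δ (by
    rw [← Finset.card_pos]; omega)
  have hb₂X : b₂ ∈ X := Finset.mem_of_mem_erase hb₂
  have hb₃X : b₃ ∈ X := Finset.mem_of_mem_erase (Finset.mem_of_mem_erase hb₃)
  have n12 : b₁ ≠ b₂ := (Finset.ne_of_mem_erase hb₂).symm
  have n23 : b₂ ≠ b₃ := (Finset.ne_of_mem_erase hb₃).symm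
  have n13 : b₁ ≠ b₃ := (Finset.ne_of_mem_erase (Finset.mem_of_mem_erase hb₃)).symm
  have le2 : ∀ x ∈ X, x ≠ b₁ → δ x ≤ δ b₂ := fun x hx h1 => max₂ x (Finset.mem_erase.2 ⟨h1, hx⟩)
  have le3 : ∀ x ∈ X, x ≠ b₁ → x ≠ b₂ → δ x ≤ δ b₃ := fun x hx h1 h2 =>
    max₃ x (Finset.mem_erase.2 ⟨h2, Finset.mem_erase.2 ⟨h1, hx⟩⟩)
  have d12 : δ b₂ ≤ δ b₁ := max₁ b₂ hb₂X
  have d23 : δ b₃ ≤ δ b₂ := le2 b₃ hb₃X n13.symm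
  have loop₂ : q ≤ 2 * δ b₂ + 1 := by
    obtain ⟨u, hu, v, hv, nu, nv, huv⟩ := h.exists_avoiding hb₁ (by omega)
    have := h.wt' hu hv huv
    have := le2 u hu nu
    have := le2 v hv nv
    omega
  -- Two elements have only three pairwise sums, while `D.card ≥ 5`.
  have edge₁₃ : q ≤ δ b₁ + δ b₃ + 1 := by
    obtain ⟨u, hu, v, hv, nu, huv⟩ := h.exists_outside {b₁, b₂} {b₁ + b₁, b₁ + b₂, b₂ + b₂} (by
      intro u hu v hv
      simp only [Finset.mem_insert, Finset.mem_singleton] at hu hv ⊢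
      omega) (Finset.card_le_three.trans_lt (by omega))
    simp only [Finset.mem_insert, Finset.mem_singleton, not_or] at nu
    have := h.wt' hu hv huv
    have := le3 u hu nu.1 nu.2
    have := max₁ v hv
    omega
  have loop₁ : q ≤ 2 * δ b₁ := by
    obtain ⟨a, ha, b, hb, hab⟩ := h.split g hgD
    have w1 := h.wt a ha b hb (hab ▸ hgD)
    have w2 := h.one g hgX
    have w3 := h.eps (a + b)
    have := max₁ a ha
    have := max₁ b hb
    rw [hab] at w1 w3
    omega
  have one₃ := h.one b₃ hb₃X
  have sum₃ := h.card_sdiff_add_sum_le (B := {b₁, b₂, b₃})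
    (by simp [Finset.insert_subset_iff, hb₁, hb₂X, hb₃X])
  rw [Finset.sum_insert (by simp [n12, n13]), Finset.sum_pair n23,
    Finset.card_eq_three.2 ⟨b₁, b₂, b₃, n12, n13, n23, rfl⟩] at sum₃
  set Λ := ∑ x ∈ X, δ x with hΛ
  have edge₂₃ : P.card + 3 ≤ D.card → q ≤ δ b₂ + δ b₃ + 1 := by
    intro hd3
    obtain ⟨u, hu, v, hv, nu, nv, huv, hq'⟩ := h.exists_ne_avoiding hb₁ hd3
    have lu := le2 u hu nu
    have lv := le2 v hv nv
    by_cases hu2 : u = b₂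
    · have := le3 v hv nv (by omega)
      omega
    · have := le3 u hu nu hu2
      omega
  by_cases hX3 : X.card = 3
  -- The cardinality bounds leave only `P.card = 2`, `r = 1`.
  · have := edge₂₃ (by omega)
    have e4 : e = 4 := by omega
    have d5 : D.card = 5 := by omega
    rw [e4, d5]
    omega
  by_cases hd1 : D.card = e + 1
  · have h1 : 3 * q ≤ 2 * Λ + 1 := by omega
    rw [hd1]
    nlinarith [Nat.mul_le_mul_left e h1, Nat.mul_le_mul_right q he]
  have edge := edge₂₃ (by omega)
  by_cases hX4 : X.card = 4
  · exact h.le_of_card_eq_four hgX hgD he hX4 (by omega) (by omega)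
  by_cases hd6 : D.card ≤ 6
  · have e4 : e = 4 := by omega
    have d6 : D.card = 6 := by omega
    rw [e4, d6]
    omega
  have c3 : (((X.erase b₁).erase b₂).erase b₃).card = X.card - 3 := by
    rw [Finset.card_erase_of_mem hb₃]; omega
  obtain ⟨b₄, hb₄, max₄⟩ := Finset.exists_max_image (((X.erase b₁).erase b₂).erase b₃) δ (by
    rw [← Finset.card_pos]; omega)
  simp only [Finset.mem_erase] at hb₄ max₄
  obtain ⟨n34, n24, n14, hb₄X⟩ := hb₄
  have le4 : ∀ x ∈ X, x ∉ ({b₁, b₂, b₃} : Finset ℕ) → δ x ≤ δ b₄ := by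
    intro x hx hxb
    simp only [Finset.mem_insert, Finset.mem_singleton, not_or] at hxb
    exact max₄ x ⟨hxb.2.2, hxb.2.1, hxb.1, hx⟩
  have edge₁₄ : q ≤ δ b₁ + δ b₄ + 1 := by
    obtain ⟨u, hu, v, hv, nu, huv⟩ := h.exists_outside {b₁, b₂, b₃}
      {b₁ + b₁, b₁ + b₂, b₂ + b₂, b₁ + b₃, b₂ + b₃, b₃ + b₃} (by
      intro u hu v hv
      simp only [Finset.mem_insert, Finset.mem_singleton] at hu hv ⊢
      rcases hu with rfl | rfl | rfl <;> rcases hv with rfl | rfl | rfl <;> simp [add_comm])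
      (Finset.card_le_six.trans_lt (by omega))
    have := h.wt' hu hv huv
    have := le4 u hu nu
    have := max₁ v hv
    omega
  have sum₄ := h.card_sdiff_add_sum_le (B := {b₁, b₂, b₃, b₄})
    (by simp [Finset.insert_subset_iff, hb₁, hb₂X, hb₃X, hb₄X])
  rw [Finset.sum_insert (by simp [n12, n13, n14.symm]), Finset.sum_insert (by simp [n23, n24.symm]),
    Finset.sum_pair n34.symm, Finset.card_insert_of_notMem (by simp [n12, n13, n14.symm]),
    Finset.card_eq_three.2 ⟨b₂, b₃, b₄, n23, n24.symm, n34.symm, rfl⟩] at sum₄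
  rw [← hΛ] at sum₄
  have hd2 : D.card ≤ 2 * e := by omega
  by_cases hΛ2 : 2 * q ≤ Λ
  · nlinarith [Nat.mul_le_mul_left q hd2, Nat.mul_le_mul_left e hΛ2]
  -- Equality holds throughout: `δ b₁ + δ b₄ = δ b₂ + δ b₃ = q - 1`. Hence `D.card ≤ ρ + 4 ≤ ρ + e`,
  -- which makes up for the missing unit in `Λ`.
  have hΛ1 : Λ = 2 * q - 1 := by omega
  have h4 := h.card_le_sum_eps_add_four d12 d23 le4 max₁ (by omega) (by omega)
  have h5 := h.eps_sum
  obtain ⟨q', rfl⟩ : ∃ q', q = q' + 1 := ⟨q - 1, by omega⟩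
  rw [hΛ1, show 2 * (q' + 1) - 1 = 2 * q' + 1 by omega]
  nlinarith [Nat.mul_le_mul_left q' hd2]

end SumGraph

/-! ### Apéry elements, and the type for at most three generators. -/

namespace NumericalSemigroup

/-- `x` is an Apéry element of `T` with respect to `m`. -/
def IsApery (T : NumericalSemigroup) (m x : ℕ) : Prop :=
  x ∈ T ∧ ∀ y ∈ T, y + m ≠ x

theorem isApery_of_add {T : NumericalSemigroup} {m x y : ℕ} (hx : x ∈ T) (hy : y ∈ T)
    (h : T.IsApery m (x + y)) : T.IsApery m x :=
  ⟨hx, fun w hw e => h.2 (w + y) (add_mem hw hy) (by omega)⟩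

theorem isApery_zero (T : NumericalSemigroup) {m : ℕ} (hm : 0 < m) : T.IsApery m 0 :=
  ⟨zero_mem T, fun y _ => by omega⟩

theorem mul_mem (T : NumericalSemigroup) {x : ℕ} (hx : x ∈ T) (k : ℕ) : k * x ∈ T := by
  simpa using nsmul_mem hx k

theorem exists_isApery (T : NumericalSemigroup) {m : ℕ} (hm : 0 < m) (x : ℕ) (hx : x ∈ T) :
    ∃ w k, T.IsApery m w ∧ x = w + k * m := by
  induction x using Nat.strong_induction_on with
  | _ x ih =>
    by_cases h : T.IsApery m x
    · exact ⟨x, 0, h, by simp⟩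
    · simp only [IsApery, hx, true_and, not_forall, not_not] at h
      obtain ⟨y, hy, rfl⟩ := h
      obtain ⟨w, k, hw, rfl⟩ := ih y (by omega) hy
      exact ⟨w, k + 1, hw, by ring⟩

/-- An Apéry element is the least element of `T` in its class modulo `m`. -/
theorem IsApery.eq_of_add_mul {T : NumericalSemigroup} {m x y j k : ℕ} (hm : m ∈ T)
    (hx : T.IsApery m x) (hy : T.IsApery m y) (h : x + j * m = y + k * m) : x = y := by
  have aux : ∀ {x y j k : ℕ}, T.IsApery m x → T.IsApery m y → x + j * m = y + k * m →
      j ≤ k := by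
    intro x y j k hx hy h
    by_contra hjk
    obtain ⟨l, rfl⟩ : ∃ l, j = k + l + 1 := ⟨j - k - 1, by omega⟩
    refine hy.2 (x + l * m) (add_mem hx.1 (T.mul_mem hm l)) ?_
    have : (k + l + 1) * m = k * m + l * m + m := by ring
    omega
  have := le_antisymm (aux hx hy h) (aux hy hx h.symm)
  subst this
  omega

/-- The maximal Apéry elements. -/
def IsMaxApery (T : NumericalSemigroup) (m z : ℕ) : Prop :=
  T.IsApery m z ∧ ∀ s ∈ T, s ≠ 0 → ¬ T.IsApery m (z + s)

/-- The conductor is at most (type + 1) times the number of left elements. -/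
theorem le_mul_card_of_maxApery (T : NumericalSemigroup) {m c : ℕ} (hm : 0 < m) (hmT : m ∈ T)
    (hc : ∀ n, c ≤ n → n ∈ T) (L M : Finset ℕ) (hL : ∀ a, a ∈ T → a < c → a ∈ L)
    (hM : ∀ z, T.IsMaxApery m z → z ∈ M) : c ≤ (M.card + 1) * L.card := by
  have key : Finset.range c ⊆ L ∪ (M ×ˢ L).image (fun p => p.1 - m - p.2) := by
    intro k hk
    rw [Finset.mem_range] at hk
    rw [Finset.mem_union]
    by_cases hkT : k ∈ T
    · exact Or.inl (hL k hkT hk)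
    right
    -- For the largest such `s`, the gap `k + s` is pseudo-Frobenius, so `k + s + m` is maximal
    -- Apéry; it and `s` determine `k`.
    have hfin : {s | s ∈ T ∧ k + s ∉ T}.Finite :=
      (Set.finite_lt_nat c).subset fun s hs => by
        by_contra h
        exact hs.2 (hc _ (by simp only [Set.mem_ofPred, not_lt] at h; omega))
    obtain ⟨s, ⟨hs, hks⟩, hmax⟩ := Set.exists_max_image _ id hfin ⟨0, zero_mem T, by simpa⟩
    have hz : ∀ t ∈ T, t ≠ 0 → k + s + t ∈ T := by
      intro t ht ht0
      by_contra hcon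
      have := hmax (s + t) ⟨add_mem hs ht, by rwa [← add_assoc]⟩
      simp only [id] at this
      omega
    have hmax' : T.IsMaxApery m (k + s + m) := by
      refine ⟨⟨hz m hmT hm.ne', fun y hy e => hks ?_⟩, fun t ht ht0 h => ?_⟩
      · rwa [show k + s = y by omega]
      · exact h.2 (k + s + t) (hz t ht ht0) (by omega)
    rw [Finset.mem_image]
    refine ⟨(k + s + m, s), Finset.mem_product.2 ⟨hM _ hmax', hL s hs ?_⟩, by simp⟩
    by_contra h
    exact hks (hc _ (by omega))
  have h1 := Finset.card_le_card key
  rw [Finset.card_range] at h1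
  have h2 := Finset.card_union_le L ((M ×ˢ L).image (fun p => p.1 - m - p.2))
  have h3 : ((M ×ˢ L).image (fun p => p.1 - m - p.2)).card ≤ M.card * L.card := by
    rw [← Finset.card_product]
    exact Finset.card_image_le
  rw [add_mul, one_mul]
  omega

theorem exists_combination {T : NumericalSemigroup} {m x y : ℕ} (hm : 0 < m)
    (hP : T.primitives ⊆ {m, x, y}) (z : ℕ) (hz : T.IsApery m z) :
    ∃ i j : ℕ, z = i * x + j * y := by
  induction z using Nat.strong_induction_on with
  | _ z ih =>
    by_cases h0 : z = 0
    · exact ⟨0, 0, by simp [h0]⟩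
    by_cases hp : z ∈ T.primitives
    · rcases hP hp with rfl | rfl | rfl
      · exact absurd (zero_add z) (hz.2 0 (zero_mem T))
      · exact ⟨1, 0, by simp⟩
      · exact ⟨0, 1, by simp⟩
    · simp only [primitives, Set.mem_ofPred, hz.1, h0, ne_eq, not_false_eq_true, true_and,
        not_forall, not_not] at hp
      obtain ⟨a, ha, b, hb, ha0, hb0, rfl⟩ := hp
      obtain ⟨i, j, rfl⟩ := ih a (by omega) (isApery_of_add ha hb hz)
      obtain ⟨i', j', rfl⟩ := ih b (by omega) (isApery_of_add hb ha (by rwa [add_comm]))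
      exact ⟨i + i', j + j', by ring⟩

/-- The canonical exponent pairs of Apéry elements in a semigroup generated by `m, x, y`. -/
def IsCanonical (T : NumericalSemigroup) (m x y i j : ℕ) : Prop :=
  T.IsApery m (i * x + j * y) ∧ ∀ i' j', i' * x + j' * y = i * x + j * y → i ≤ i'

section Three

variable {T : NumericalSemigroup} {m x y : ℕ}

theorem combination_mem (hxT : x ∈ T) (hyT : y ∈ T) (i j : ℕ) : i * x + j * y ∈ T :=
  add_mem (T.mul_mem hxT i) (T.mul_mem hyT j)

/-- Canonical pairs form a staircase in ℕ²: a competitor for the smaller pair translates to one for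
the larger. -/
theorem IsCanonical.mono (hxT : x ∈ T) (hyT : y ∈ T) {i j i' j' : ℕ}
    (h : T.IsCanonical m x y i' j') (hi : i ≤ i') (hj : j ≤ j') : T.IsCanonical m x y i j := by
  obtain ⟨k, rfl⟩ := Nat.exists_eq_add_of_le hi
  obtain ⟨l, rfl⟩ := Nat.exists_eq_add_of_le hj
  refine ⟨isApery_of_add (combination_mem hxT hyT i j) (combination_mem hxT hyT k l) ?_,
    fun i' j' e => ?_⟩
  · convert h.1 using 1; ring
  · have := h.2 (i' + k) (j' + l) (by simp only [add_mul]; omega)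
    omega

theorem IsCanonical.unique (hy : 0 < y) {i j i' j' : ℕ} (h : T.IsCanonical m x y i j)
    (h' : T.IsCanonical m x y i' j') (e : i * x + j * y = i' * x + j' * y) :
    i = i' ∧ j = j' := by
  have hi : i = i' := le_antisymm (h.2 _ _ e.symm) (h'.2 _ _ e)
  subst hi
  exact ⟨rfl, Nat.eq_of_mul_eq_mul_right hy (by omega)⟩

theorem exists_isCanonical (hm : 0 < m) (hP : T.primitives ⊆ {m, x, y}) {z : ℕ}
    (hz : T.IsApery m z) : ∃ i j, T.IsCanonical m x y i j ∧ z = i * x + j * y := by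
  classical
  have hex := exists_combination hm hP z hz
  obtain ⟨j, hj⟩ := Nat.find_spec hex
  refine ⟨Nat.find hex, j, ⟨hj ▸ hz, fun i' j' e => ?_⟩, hj⟩
  exact Nat.find_min' hex ⟨j', by rw [e, ← hj]⟩

/-- Take the canonical pair of the Apéry element in the corner's class. If it had a positive
exponent, cancelling `x` or `y` would identify it, by uniqueness, with a neighbour of the corner,
which is impossible. So that element is 0. -/
theorem exists_eq_mul_of_corner (hm : 0 < m) (hmT : m ∈ T) (hxT : x ∈ T) (hyT : y ∈ T)
    (hy : 0 < y) (hP : T.primitives ⊆ {m, x, y}) {a b : ℕ}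
    (h1 : T.IsCanonical m x y a (b + 1)) (h2 : T.IsCanonical m x y (a + 1) b)
    (h3 : ¬ T.IsCanonical m x y (a + 1) (b + 1)) : ∃ k, (a + 1) * x + (b + 1) * y = k * m := by
  obtain ⟨w, k, hw, e⟩ := T.exists_isApery hm _ (combination_mem hxT hyT (a + 1) (b + 1))
  obtain ⟨i, j, hij, rfl⟩ := exists_isCanonical hm hP hw
  rcases i with _ | i
  · rcases j with _ | j
    · exact ⟨k, by simpa using e⟩
    · have h4 := hij.mono hxT hyT le_rfl (Nat.le_succ j)
      have e' : (a + 1) * x + b * y + 0 * m = 0 * x + j * y + k * m := by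
        simp only [add_mul] at e ⊢
        omega
      obtain ⟨q1, q2⟩ := h2.unique hy h4 (h2.1.eq_of_add_mul hmT h4.1 e')
      omega
  · have h4 := hij.mono hxT hyT (Nat.le_succ i) le_rfl
    have e' : a * x + (b + 1) * y + 0 * m = i * x + j * y + k * m := by
      simp only [add_mul] at e ⊢
      omega
    obtain ⟨q1, q2⟩ := h1.unique hy h4 (h1.1.eq_of_add_mul hmT h4.1 e')
    subst q1 q2
    exact absurd hij h3

/-- Subtraction makes a multiple of `x` congruent to a multiple of `y` modulo `m`. Both are Apéry,
hence equal, against minimality of the first exponent. -/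
theorem false_of_two_corners (hmT : m ∈ T) (hxT : x ∈ T) (hyT : y ∈ T)
    {a b a' b' k k' : ℕ} (ha : a < a') (hb : b' < b) (h1 : T.IsCanonical m x y 0 b)
    (h2 : T.IsCanonical m x y a' 0) (e : a * x + b * y = k * m)
    (e' : a' * x + b' * y = k' * m) : False := by
  obtain ⟨u, rfl⟩ := Nat.exists_eq_add_of_lt ha
  obtain ⟨v, rfl⟩ := Nat.exists_eq_add_of_lt hb
  have g1 : T.IsCanonical m x y 0 (v + 1) := h1.mono hxT hyT le_rfl (by omega)
  have g2 : T.IsCanonical m x y (u + 1) 0 := h2.mono hxT hyT (by omega) le_rfl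
  have := g1.1.eq_of_add_mul (j := k') (k := k) hmT g2.1 (by
    rw [← e, ← e']
    ring)
  have := g2.2 _ _ this
  omega

theorem exists_corner (hxT : x ∈ T) (hyT : y ∈ T) {i j i' j' : ℕ}
    (h : T.IsCanonical m x y i j) (h' : T.IsCanonical m x y i' j')
    (hn : ¬ T.IsCanonical m x y i' j) :
    ∃ a b, i ≤ a ∧ a < i' ∧ j' ≤ b ∧ b < j ∧ T.IsCanonical m x y a (b + 1) ∧
      T.IsCanonical m x y (a + 1) b ∧ ¬ T.IsCanonical m x y (a + 1) (b + 1) := by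
  classical
  have hex : ∃ a, ¬ T.IsCanonical m x y a j := ⟨i', hn⟩
  have s1 := Nat.find_spec hex
  have s2 := Nat.find_min' hex hn
  have s3 : ∀ a < Nat.find hex, T.IsCanonical m x y a j := fun a ha =>
    not_not.1 (Nat.find_min hex ha)
  have s4 : i < Nat.find hex := by
    by_contra hcon
    exact s1 (h.mono hxT hyT (by omega) le_rfl)
  generalize Nat.find hex = A at *
  have hex' : ∃ b, ¬ T.IsCanonical m x y A b := ⟨j, s1⟩
  have t1 := Nat.find_spec hex'
  have t2 := Nat.find_min' hex' s1
  have t3 : ∀ b < Nat.find hex', T.IsCanonical m x y A b := fun a ha =>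
    not_not.1 (Nat.find_min hex' ha)
  have t4 : j' < Nat.find hex' := by
    by_contra hcon
    exact t1 (h'.mono hxT hyT s2 (by omega))
  generalize Nat.find hex' = B at *
  obtain ⟨a, rfl⟩ : ∃ a, A = a + 1 := ⟨A - 1, by omega⟩
  obtain ⟨b, rfl⟩ : ∃ b, B = b + 1 := ⟨B - 1, by omega⟩
  exact ⟨a, b, by omega, by omega, by omega, by omega,
    (s3 a (by omega)).mono hxT hyT le_rfl t2, t3 b (by omega), t1⟩

theorem IsMaxApery.not_isApery_of_le (hxT : x ∈ T) (hyT : y ∈ T) (hx : 0 < x) (hy : 0 < y)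
    {i j i' j' : ℕ} (h : T.IsMaxApery m (i * x + j * y)) (hi : i ≤ i') (hj : j ≤ j')
    (hne : i < i' ∨ j < j') : ¬ T.IsApery m (i' * x + j' * y) := by
  obtain ⟨k, rfl⟩ := Nat.exists_eq_add_of_le hi
  obtain ⟨l, rfl⟩ := Nat.exists_eq_add_of_le hj
  have h0 : k * x + l * y ≠ 0 := by
    rcases hne with h1 | h1
    · have : 0 < k * x := Nat.mul_pos (by omega) hx
      omega
    · have : 0 < l * y := Nat.mul_pos (by omega) hy
      omega
  have := h.2 _ (combination_mem hxT hyT k l) h0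
  convert this using 2
  ring

/-- A numerical semigroup with at most three generators has at most two maximal Apéry
elements. -/
theorem card_maxApery_le_two (hm : 0 < m) (hmT : m ∈ T) (hxT : x ∈ T) (hyT : y ∈ T)
    (hx : 0 < x) (hy : 0 < y) (hP : T.primitives ⊆ {m, x, y}) (M : Finset ℕ)
    (hM : ∀ z ∈ M, T.IsMaxApery m z) : M.card ≤ 2 := by
  have hcan : ∀ z ∈ M, ∃ i j, T.IsCanonical m x y i j ∧ z = i * x + j * y := fun z hz =>
    exists_isCanonical hm hP (hM z hz).1
  choose! f g hc he using hcan
  have anti : ∀ z ∈ M, ∀ w ∈ M, f z < f w → g w < g z := by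
    intro z hz w hw hlt
    by_contra hcon
    exact (he z hz ▸ hM z hz).not_isApery_of_le hxT hyT hx hy hlt.le (by omega) (Or.inl hlt)
      (hc w hw).1
  have inj : ∀ z ∈ M, ∀ w ∈ M, f z = f w → z = w := by
    intro z hz w hw e
    rcases lt_trichotomy (g z) (g w) with h | h | h
    · exact absurd (hc w hw).1 ((he z hz ▸ hM z hz).not_isApery_of_le hxT hyT hx hy e.le h.le
        (Or.inr h))
    · rw [he z hz, he w hw, e, h]
    · exact absurd (hc z hz).1 ((he w hw ▸ hM w hw).not_isApery_of_le hxT hyT hx hy e.ge h.le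
        (Or.inr h))
  -- Three maximal elements form an antichain of exponent pairs, so the staircase has two inner
  -- corners, both divisible by `m`.
  have key : ∀ z₁ ∈ M, ∀ z₂ ∈ M, ∀ z₃ ∈ M, f z₁ < f z₂ → f z₂ < f z₃ → False := by
    intro z₁ h₁ z₂ h₂ z₃ h₃ l12 l23
    have corner : ∀ z ∈ M, ∀ w ∈ M, f z < f w → ∃ a b, f z ≤ a ∧ a < f w ∧ g w ≤ b ∧ b < g z ∧
        T.IsCanonical m x y a (b + 1) ∧ T.IsCanonical m x y (a + 1) b ∧
        ¬ T.IsCanonical m x y (a + 1) (b + 1) := fun z hz w hw hlt =>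
      exists_corner hxT hyT (hc z hz) (hc w hw) fun hcon =>
        (he z hz ▸ hM z hz).not_isApery_of_le hxT hyT hx hy hlt.le le_rfl (Or.inl hlt) hcon.1
    obtain ⟨a, b, -, p2, p3, -, p5, p6, p7⟩ := corner z₁ h₁ z₂ h₂ l12
    obtain ⟨a', b', q1, -, -, q4, q5, q6, q7⟩ := corner z₂ h₂ z₃ h₃ l23
    obtain ⟨k, hk⟩ := exists_eq_mul_of_corner hm hmT hxT hyT hy hP p5 p6 p7
    obtain ⟨k', hk'⟩ := exists_eq_mul_of_corner hm hmT hxT hyT hy hP q5 q6 q7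
    exact false_of_two_corners hmT hxT hyT (by omega) (by omega)
      (p5.mono hxT hyT (Nat.zero_le _) le_rfl) (q6.mono hxT hyT le_rfl (Nat.zero_le _)) hk hk'
  by_contra hcard
  obtain ⟨a, ha, b, hb, c, hc', hab, hac, hbc⟩ := Finset.two_lt_card.1 (by omega : 2 < M.card)
  have n1 : f a ≠ f b := fun e => hab (inj a ha b hb e)
  have n2 : f a ≠ f c := fun e => hac (inj a ha c hc' e)
  have n3 : f b ≠ f c := fun e => hbc (inj b hb c hc' e)
  rcases lt_or_gt_of_ne n1 with h | h <;> rcases lt_or_gt_of_ne n2 with h' | h' <;>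
    rcases lt_or_gt_of_ne n3 with h'' | h''
  · exact key a ha b hb c hc' h h''
  · exact key a ha c hc' b hb h' h''
  · omega
  · exact key c hc' a ha b hb h' h
  · exact key b hb a ha c hc' h h'
  · omega
  · exact key b hb c hc' a ha h'' h'
  · exact key c hc' b hb a ha h'' h

end Three

theorem card_maxApery_le_one {T : NumericalSemigroup} {m x : ℕ} (hm : 0 < m) (hxT : x ∈ T)
    (hx : 0 < x) (hP : T.primitives ⊆ {m, x}) (M : Finset ℕ)
    (hM : ∀ z ∈ M, T.IsMaxApery m z) : M.card ≤ 1 := by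
  have hP' : T.primitives ⊆ {m, x, x} := by simpa using hP
  have aux : ∀ i j : ℕ, i < j → T.IsMaxApery m (i * x) → ¬ T.IsApery m (j * x) := by
    intro i j hij h h'
    exact (show T.IsMaxApery m (i * x + 0 * x) by simpa using h).not_isApery_of_le (i' := j)
      (j' := 0) hxT hxT hx hx hij.le le_rfl (Or.inl hij) (by simpa using h')
  rw [Finset.card_le_one]
  intro z hz w hw
  obtain ⟨i, j, e⟩ := exists_combination hm hP' z (hM z hz).1
  obtain ⟨i', j', e'⟩ := exists_combination hm hP' w (hM w hw).1
  rw [← add_mul] at e e'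
  rcases lt_trichotomy (i + j) (i' + j') with h | h | h
  · exact absurd (e' ▸ (hM w hw).1) (aux _ _ h (e ▸ hM z hz))
  · rw [e, e', h]
  · exact absurd (e ▸ (hM z hz).1) (aux _ _ h (e' ▸ hM w hw))

end NumericalSemigroup

/-! ### Wilf's inequality in Apéry coordinates. -/

namespace NumericalSemigroup

theorem multiplicity_mem (T : NumericalSemigroup) : T.multiplicity ∈ T :=
  T.multiplicity_isLeast.1.1

theorem multiplicity_pos (T : NumericalSemigroup) : 0 < T.multiplicity :=
  Nat.pos_of_ne_zero T.multiplicity_isLeast.1.2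

theorem multiplicity_le {T : NumericalSemigroup} {a : ℕ} (ha : a ∈ T) (h0 : a ≠ 0) :
    T.multiplicity ≤ a :=
  T.multiplicity_isLeast.2 ⟨ha, h0⟩

theorem multiplicity_mem_primitives (T : NumericalSemigroup) : T.multiplicity ∈ T.primitives := by
  refine ⟨T.multiplicity_mem, T.multiplicity_pos.ne', fun x hx y hy hx0 hy0 e => ?_⟩
  have := multiplicity_le hx hx0
  omega

theorem mem_of_frobenius_lt {T : NumericalSemigroup} {n : ℕ} (h : T.frobenius < n) : n ∈ T := by
  by_contra hn
  have := T.frobenius_isGreatest.2 (show (n : ℤ) ∈ _ from fun a ha e => hn (by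
    rwa [Nat.cast_injective e] at ha))
  omega

theorem ne_frobenius {T : NumericalSemigroup} {a : ℕ} (ha : a ∈ T) : (a : ℤ) ≠ T.frobenius :=
  T.frobenius_isGreatest.1 a ha

section Depth

/-- The number of elements `x + j * m` below `c`. -/
def depth (c m x : ℕ) : ℕ := (c + m - 1 - x) / m

theorem lt_depth_iff {c m : ℕ} (hm : 0 < m) (x j : ℕ) : j < depth c m x ↔ x + j * m < c := by
  rw [depth, ← Nat.succ_le_iff, Nat.le_div_iff_mul_le hm, Nat.succ_mul]
  omega

theorem le_depth_mul_add {c m : ℕ} (hm : 0 < m) (x : ℕ) : c ≤ x + depth c m x * m := by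
  by_contra h
  exact lt_irrefl _ ((lt_depth_iff hm x (depth c m x)).2 (by omega))

theorem depth_mul_add_lt {c m : ℕ} (hm : 0 < m) {x : ℕ} (hx : x < c + m) :
    x + depth c m x * m < c + m := by
  rcases h : depth c m x with _ | k
  · omega
  · have := (lt_depth_iff (c := c) hm x k).1 (by omega)
    rw [add_mul]
    omega

end Depth

section Wilf

variable (T : NumericalSemigroup) (m c : ℕ)

open Classical in
/-- The Apéry elements, which all lie below `c + m`. -/
noncomputable def apery : Finset ℕ := (Finset.range (c + m)).filter (T.IsApery m)

open Classical in
/-- The nonzero Apéry elements below the conductor. -/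
noncomputable def smallApery : Finset ℕ := (T.apery m c).filter (fun x => x ≠ 0 ∧ x < c)

open Classical in
/-- The primitive Apéry elements below the conductor. -/
noncomputable def smallPrim : Finset ℕ :=
  (T.apery m c).filter (fun x => x < c ∧ x ∈ T.primitives)

open Classical in
/-- The primitive Apéry elements above the conductor. -/
noncomputable def largePrim : Finset ℕ :=
  (T.apery m c).filter (fun x => c ≤ x ∧ x ∈ T.primitives)

open Classical in
/-- The decomposable nonzero Apéry elements. -/
noncomputable def decomp : Finset ℕ :=
  (T.apery m c).filter (fun x => x ≠ 0 ∧ x ∉ T.primitives)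

variable {T m c}

theorem mem_apery (hc : ∀ n, c ≤ n → n ∈ T) {x : ℕ} : x ∈ T.apery m c ↔ T.IsApery m x := by
  simp only [apery, Finset.mem_filter, Finset.mem_range, and_iff_right_iff_imp]
  intro hx
  by_contra h
  exact hx.2 (x - m) (hc _ (by omega)) (by omega)

theorem card_apery (hm : 0 < m) (hmT : m ∈ T) (hc : ∀ n, c ≤ n → n ∈ T) :
    (T.apery m c).card = m := by
  conv_rhs => rw [← Finset.card_range m]
  refine Finset.card_bij (fun x _ => x % m) (fun x _ => Finset.mem_range.2 (Nat.mod_lt _ hm))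
    ?_ ?_
  · intro x hx y hy e
    rw [mem_apery hc] at hx hy
    refine hx.eq_of_add_mul (j := y / m) (k := x / m) hmT hy ?_
    have h1 := Nat.mod_add_div x m
    have h2 := Nat.mod_add_div y m
    rw [mul_comm] at h1 h2
    omega
  · intro i hi
    rw [Finset.mem_range] at hi
    obtain ⟨w, k, hw, e⟩ := T.exists_isApery hm (i + c * m) (hc _ (by nlinarith))
    refine ⟨w, (mem_apery hc).2 hw, ?_⟩
    have := congrArg (· % m) e
    simp only [Nat.add_mul_mod_self_right] at this
    rw [← this, Nat.mod_eq_of_lt hi]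

theorem card_apery_eq (hm : 0 < m) (hc : ∀ n, c ≤ n → n ∈ T) :
    (T.apery m c).card = 1 + (T.smallPrim m c).card + (T.largePrim m c).card +
      (T.decomp m c).card := by
  classical
  have h0 : ((T.apery m c).filter (fun x => x = 0)).card = 1 := by
    rw [Finset.filter_eq', if_pos ((mem_apery hc).2 (T.isApery_zero hm)), Finset.card_singleton]
  rw [← h0, smallPrim, largePrim, decomp, Finset.card_filter, Finset.card_filter,
    Finset.card_filter, Finset.card_filter, ← Finset.sum_add_distrib, ← Finset.sum_add_distrib,
    ← Finset.sum_add_distrib, Finset.card_eq_sum_ones]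
  refine Finset.sum_congr rfl fun x _ => ?_
  by_cases hp : x ∈ T.primitives
  · have := hp.2.1
    by_cases hxc : x < c
    · simp [hp, this, hxc]
    · simp [hp, this, hxc, not_lt.1 hxc]
  · by_cases hx0 : x = 0
    · subst hx0; simp [hp]
    · simp [hp, hx0]

theorem isApery_of_mem_primitives {p : ℕ} (hmT : m ∈ T) (hm : 0 < m) (hp : p ∈ T.primitives)
    (hpm : p ≠ m) : T.IsApery m p :=
  ⟨hp.1, fun y hy e => hp.2.2 y hy m hmT (by omega) hm.ne' e⟩

theorem not_isApery_self : ¬ T.IsApery m m := fun h => h.2 0 (zero_mem T) (zero_add m)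

theorem embeddingDim_eq (hm : m ∈ T.primitives) (hc : ∀ n, c ≤ n → n ∈ T) :
    T.embeddingDim = (T.smallPrim m c).card + 1 + (T.largePrim m c).card := by
  classical
  have h : T.primitives =
      ((insert m (T.smallPrim m c ∪ T.largePrim m c) : Finset ℕ) : Set ℕ) := by
    ext p
    simp only [smallPrim, largePrim, Finset.coe_insert, Finset.coe_union, Finset.coe_filter,
      Set.mem_insert_iff, Set.mem_union, Set.mem_ofPred, mem_apery hc]
    constructor
    · intro hp
      by_cases hpm : p = m
      · exact Or.inl hpm
      · have := isApery_of_mem_primitives hm.1 (Nat.pos_of_ne_zero hm.2.1) hp hpm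
        rcases lt_or_ge p c with h | h
        · exact Or.inr (Or.inl ⟨this, h, hp⟩)
        · exact Or.inr (Or.inr ⟨this, h, hp⟩)
    · rintro (rfl | h | h)
      · exact hm
      · exact h.2.2
      · exact h.2.2
  rw [embeddingDim, h, Set.ncard_coe_finset, Finset.card_insert_of_notMem, Finset.card_union_of_disjoint]
  · omega
  · rw [Finset.disjoint_left]
    intro x hx hx'
    simp only [smallPrim, largePrim, Finset.mem_filter] at hx hx'
    omega
  · simp [smallPrim, largePrim, mem_apery hc, not_isApery_self]

theorem numLeftPrimitives_eq (hm : m ∈ T.primitives) (hc : ∀ n, c ≤ n → n ∈ T) (hmc : m < c)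
    (hF : T.frobenius + 1 = c) :
    T.numLeftPrimitives = (T.smallPrim m c).card + 1 := by
  classical
  have h : T.primitives ∩ T.leftPart = ((insert m (T.smallPrim m c) : Finset ℕ) : Set ℕ) := by
    ext p
    simp only [smallPrim, Finset.coe_insert, Finset.coe_filter, leftPart, Set.mem_inter_iff,
      Set.mem_insert_iff, Set.mem_ofPred, mem_apery hc]
    constructor
    · rintro ⟨hp, -, hpF⟩
      by_cases hpm : p = m
      · exact Or.inl hpm
      · exact Or.inr ⟨isApery_of_mem_primitives hm.1 (Nat.pos_of_ne_zero hm.2.1) hp hpm,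
          by omega, hp⟩
    · have key : p ∈ T.primitives → p < c → p ∈ T.primitives ∧ p ∈ T ∧ (p : ℤ) < T.frobenius := by
        intro hp hpc
        have := ne_frobenius hp.1
        exact ⟨hp, hp.1, by omega⟩
      rintro (rfl | h)
      · exact key hm hmc
      · exact key h.2.2 h.2.1
  rw [numLeftPrimitives, h, Set.ncard_coe_finset, Finset.card_insert_of_notMem]
  simp [smallPrim, mem_apery hc, not_isApery_self]

/-- Each left element is uniquely `w + k * m` with `w` Apéry, and `w` accounts for `depth c m w` of
them. -/
theorem ncard_leftPart_eq (hm : 0 < m) (hmT : m ∈ T) (hc : ∀ n, c ≤ n → n ∈ T)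
    (hF : T.frobenius + 1 = c) :
    T.leftPart.ncard = depth c m 0 + ∑ x ∈ T.smallApery m c, depth c m x := by
  classical
  have h1 : T.leftPart = (((Finset.range c).filter (· ∈ T) : Finset ℕ) : Set ℕ) := by
    ext a
    simp only [leftPart, Finset.coe_filter, Finset.mem_range, Set.mem_ofPred]
    constructor
    · rintro ⟨h, h'⟩
      exact ⟨by omega, h⟩
    · rintro ⟨h, h'⟩
      have := ne_frobenius h'
      exact ⟨h', by omega⟩
  have h2 : ((T.apery m c).sigma (fun x => Finset.range (depth c m x))).card =
      ((Finset.range c).filter (· ∈ T)).card := by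
    refine Finset.card_bij (fun p _ => p.1 + p.2 * m) ?_ ?_ ?_
    · rintro ⟨x, j⟩ hp
      simp only [Finset.mem_sigma, mem_apery hc, Finset.mem_range, lt_depth_iff hm] at hp
      simp only [Finset.mem_filter, Finset.mem_range]
      exact ⟨hp.2, add_mem hp.1.1 (T.mul_mem hmT j)⟩
    · rintro ⟨x, j⟩ hp ⟨y, k⟩ hp' e
      simp only [Finset.mem_sigma, mem_apery hc] at hp hp' e
      obtain rfl := hp.1.eq_of_add_mul hmT hp'.1 e
      obtain rfl : j = k := Nat.eq_of_mul_eq_mul_right hm (by omega)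
      rfl
    · intro a ha
      simp only [Finset.mem_filter, Finset.mem_range] at ha
      obtain ⟨w, k, hw, rfl⟩ := T.exists_isApery hm a ha.2
      refine ⟨⟨w, k⟩, ?_, rfl⟩
      simp only [Finset.mem_sigma, mem_apery hc, Finset.mem_range, lt_depth_iff hm]
      exact ⟨hw, ha.1⟩
  have h3 : 0 ∉ T.smallApery m c := by simp [smallApery]
  rw [h1, Set.ncard_coe_finset, ← h2, Finset.card_sigma, ← Finset.sum_insert h3]
  simp only [Finset.card_range]
  symm
  refine Finset.sum_subset ?_ ?_
  · exact Finset.insert_subset ((mem_apery hc).2 (T.isApery_zero hm)) (Finset.filter_subset _ _)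
  · intro x hx hx'
    simp only [smallApery, Finset.mem_insert, Finset.mem_filter, hx, true_and, not_or, not_and,
      not_lt] at hx'
    by_contra h
    have := (lt_depth_iff hm x 0).1 (Nat.pos_of_ne_zero h)
    have := hx'.2 hx'.1
    omega

/-- The correction term of an Apéry element. -/
def correction (c m ρ z : ℕ) : ℕ := if c + m ≤ z + depth c m z * m + ρ then 1 else 0

/-- The numbers `z + depth c m z * m` are distinct, as their classes modulo `m` are; a correction
places them among the last `ρ` integers below `c + m`. -/
theorem sum_correction_le (hm : 0 < m) (hmT : m ∈ T) (hc : ∀ n, c ≤ n → n ∈ T) (ρ : ℕ) :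
    ∑ z ∈ T.decomp m c, correction c m ρ z ≤ ρ := by
  classical
  simp only [correction]
  rw [← Finset.card_filter]
  have h : (Finset.Ico (c + m - ρ) (c + m)).card ≤ ρ := by rw [Nat.card_Ico]; omega
  refine le_trans ?_ h
  refine Finset.card_le_card_of_injOn (fun z => z + depth c m z * m) ?_ ?_
  · intro z hz
    simp only [Finset.coe_filter, Set.mem_ofPred, decomp, Finset.mem_filter, apery,
      Finset.mem_range] at hz
    have := depth_mul_add_lt hm hz.1.1.1
    simp only [Finset.coe_Ico, Set.mem_Ico]
    omega
  · intro z hz w hw e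
    simp only [Finset.coe_filter, Set.mem_ofPred, decomp, Finset.mem_filter, mem_apery hc] at hz hw
    exact hz.1.1.eq_of_add_mul hmT hw.1.1 e

theorem sumGraph (hm : m = T.multiplicity) (hc : ∀ n, c ≤ n → n ∈ T) :
    SumGraph (T.smallPrim m c) (T.decomp m c) (T.smallApery m c) (depth c m)
      (correction c m (depth c m 0 * m - c)) (depth c m 0) (depth c m 0 * m - c) := by
  have hm0 : 0 < m := hm ▸ T.multiplicity_pos
  have hmT : m ∈ T := hm ▸ T.multiplicity_mem
  have hle : ∀ a ∈ T, a ≠ 0 → m ≤ a := fun a ha h0 => hm ▸ multiplicity_le ha h0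
  have memX : ∀ {x}, x ∈ T.smallApery m c ↔ T.IsApery m x ∧ x ≠ 0 ∧ x < c := by
    simp [smallApery, mem_apery hc]
  have memD : ∀ {x}, x ∈ T.decomp m c ↔ T.IsApery m x ∧ x ≠ 0 ∧ x ∉ T.primitives := by
    simp [decomp, mem_apery hc]
  have memP : ∀ {x}, x ∈ T.smallPrim m c ↔ T.IsApery m x ∧ x < c ∧ x ∈ T.primitives := by
    simp [smallPrim, mem_apery hc]
  have lt : ∀ {x}, T.IsApery m x → x < c + m := fun {x} hx => by
    have := (mem_apery hc).2 hx
    simp only [apery, Finset.mem_filter, Finset.mem_range] at this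
    exact this.1
  refine ⟨?_, ?_, ?_, ?_, ?_, ?_, ?_, ?_, ?_, sum_correction_le hm0 hmT hc _⟩
  · intro x hx
    rw [memP] at hx
    exact memX.2 ⟨hx.1, hx.2.2.2.1, hx.2.1⟩
  · intro x hx hxP
    rw [memX] at hx
    exact memD.2 ⟨hx.1, hx.2.1, fun h => hxP (memP.2 ⟨hx.1, hx.2.2, h⟩)⟩
  · intro x hx
    exact Nat.pos_of_ne_zero (memX.1 hx).2.1
  · intro x hx y hy h
    rw [memX] at hx hy
    exact (memP.1 h).2.2.2.2 x hx.1.1 y hy.1.1 hx.2.1 hy.2.1 rfl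
  · intro z hz
    obtain ⟨h1, h2, h3⟩ := memD.1 hz
    simp only [primitives, Set.mem_ofPred, h1.1, h2, ne_eq, not_false_eq_true, true_and,
        not_forall, not_not] at h3
    obtain ⟨a, ha, b, hb, ha0, hb0, rfl⟩ := h3
    have := lt h1
    have := hle a ha ha0
    have := hle b hb hb0
    exact ⟨a, memX.2 ⟨isApery_of_add ha hb h1, ha0, by omega⟩, b,
      memX.2 ⟨isApery_of_add hb ha (by rwa [add_comm]), hb0, by omega⟩, rfl⟩
  · intro x hx y hy hz
    rw [memX] at hx hy
    have hz' := lt (memD.1 hz).1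
    have a1 := le_depth_mul_add (c := c) hm0 x
    have a2 := le_depth_mul_add (c := c) hm0 y
    have a3 := depth_mul_add_lt hm0 hz'
    have a4 := depth_mul_add_lt (c := c) hm0 (x := 0) (by omega)
    have a5 := le_depth_mul_add (c := c) hm0 0
    simp only [correction]
    generalize depth c m x = a at *
    generalize depth c m y = b at *
    generalize depth c m (x + y) = k at *
    generalize depth c m 0 = q at *
    -- Compare multiples of `m`: both `q * m` and `x + y + k * m` are below `c + m`, while `x + a *
    -- m` and `y + b * m` are at least `c`. Without a correction, `q * m = c + ρ` also rules out `q
    -- + k = a + b + 1`.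
    have h1 : q + k < a + b + 2 := by
      by_contra hcon
      have := Nat.mul_le_mul_right m (not_lt.1 hcon)
      simp only [add_mul] at this
      omega
    split_ifs with hif
    · omega
    · by_contra hcon
      have h2 : q + k = a + b + 1 := by omega
      have := congrArg (· * m) h2
      simp only [add_mul] at this
      omega
  · intro x hx y hy w hw hz
    rw [memX] at hx hy hw
    have h1 := (memD.1 hz).1
    have := lt h1
    have := hle w hw.1.1 hw.2.1
    exact memX.2 ⟨isApery_of_add (add_mem hx.1.1 hy.1.1) hw.1.1 h1, by omega, by omega⟩
  · intro x hx
    rw [memX] at hx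
    exact (lt_depth_iff hm0 x 0).2 (by omega)
  · intro z
    simp only [correction]
    split_ifs <;> omega

/-- Wilf's inequality for semigroups with two or three generators. -/
theorem le_mul_of_embeddingDim_le_three (hm : m = T.multiplicity) (hc : ∀ n, c ≤ n → n ∈ T)
    (hF : T.frobenius + 1 = c) (h2 : 2 ≤ T.embeddingDim) (h3 : T.embeddingDim ≤ 3) :
    c ≤ T.embeddingDim * T.leftPart.ncard := by
  classical
  have hm0 : 0 < m := hm ▸ T.multiplicity_pos
  have hmT : m ∈ T := hm ▸ T.multiplicity_mem
  have hmP : m ∈ T.primitives := hm ▸ T.multiplicity_mem_primitives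
  set M := (T.apery m c).filter (T.IsMaxApery m) with hMdef
  have hM : ∀ z ∈ M, T.IsMaxApery m z := fun z hz => (Finset.mem_filter.1 hz).2
  have hM' : ∀ z, T.IsMaxApery m z → z ∈ M := fun z hz =>
    Finset.mem_filter.2 ⟨(mem_apery hc).2 hz.1, hz⟩
  have hdiff : (T.primitives \ {m}).ncard + 1 = T.embeddingDim :=
    Set.ncard_sdiff_singleton_add_one hmP T.primitives_finite
  have hins : insert m (T.primitives \ {m}) = T.primitives := by
    rw [Set.insert_sdiff_singleton, Set.insert_eq_of_mem hmP]
  have hcard : M.card + 1 ≤ T.embeddingDim := by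
    rcases (by omega : (T.primitives \ {m}).ncard = 1 ∨ (T.primitives \ {m}).ncard = 2) with h | h
    · obtain ⟨x, hx⟩ := Set.ncard_eq_one.1 h
      rw [hx] at hins
      have hxP : x ∈ T.primitives := by rw [← hins]; simp
      have := card_maxApery_le_one hm0 hxP.1 (Nat.pos_of_ne_zero hxP.2.1) hins.ge M hM
      omega
    · obtain ⟨x, y, -, hx⟩ := Set.ncard_eq_two.1 h
      rw [hx] at hins
      have hxP : x ∈ T.primitives := by rw [← hins]; simp
      have hyP : y ∈ T.primitives := by rw [← hins]; simp
      have := card_maxApery_le_two hm0 hmT hxP.1 hyP.1 (Nat.pos_of_ne_zero hxP.2.1)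
        (Nat.pos_of_ne_zero hyP.2.1) hins.ge M hM
      omega
  have h := T.le_mul_card_of_maxApery hm0 hmT hc T.leftPart_finite.toFinset M (fun a ha hac => by
    rw [Set.Finite.mem_toFinset]
    have := ne_frobenius ha
    exact ⟨ha, by omega⟩) hM'
  rw [← Set.ncard_eq_toFinset_card _ T.leftPart_finite] at h
  exact h.trans (Nat.mul_le_mul_right _ hcard)

theorem satisfiesWilf_of_le (hm : T.multiplicity ≤ 3 * T.numLeftPrimitives) :
    T.SatisfiesWilf := by
  obtain ⟨p, hp, hpF⟩ : (T.primitives ∩ T.leftPart).Nonempty := by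
    rw [← Set.ncard_pos (T.primitives_finite.subset Set.inter_subset_left)]
    have := T.multiplicity_pos
    change 0 < T.numLeftPrimitives
    omega
  have hpm := multiplicity_le hp.1 hp.2.1
  have hpF' := hpF.2
  obtain ⟨c, hF⟩ : ∃ c : ℕ, T.frobenius + 1 = c := ⟨(T.frobenius + 1).toNat, by omega⟩
  have hc : ∀ n, c ≤ n → n ∈ T := fun n hn => mem_of_frobenius_lt (by omega)
  obtain ⟨m, hmdef⟩ : ∃ m, m = T.multiplicity := ⟨_, rfl⟩
  have hm0 : 0 < m := hmdef ▸ T.multiplicity_pos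
  have hmT : m ∈ T := hmdef ▸ T.multiplicity_mem
  have hmP : m ∈ T.primitives := hmdef ▸ T.multiplicity_mem_primitives
  have hmc : m < c := by omega
  have hG := sumGraph hmdef hc
  have e1 := card_apery hm0 hmT hc
  rw [card_apery_eq hm0 hc] at e1
  have e2 := embeddingDim_eq hmP hc
  have e3 := numLeftPrimitives_eq hmP hc hmc hF
  have e4 := ncard_leftPart_eq hm0 hmT hc hF
  rw [SatisfiesWilf, conductor, hF]
  suffices hs : c ≤ T.embeddingDim * T.leftPart.ncard by exact_mod_cast hs
  have hqc := le_depth_mul_add (c := c) hm0 0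
  have reduce : depth c m 0 * (T.decomp m c).card ≤
      T.embeddingDim * ∑ x ∈ T.smallApery m c, depth c m x + (depth c m 0 * m - c) →
      c ≤ T.embeddingDim * T.leftPart.ncard := by
    intro h
    have hme : m = T.embeddingDim + (T.decomp m c).card := by omega
    have : depth c m 0 * m =
        T.embeddingDim * depth c m 0 + depth c m 0 * (T.decomp m c).card := by
      rw [mul_comm T.embeddingDim, ← mul_add, ← hme]
    rw [e4, mul_add]
    omega
  by_cases hpairs : ∀ z ∈ T.decomp m c,
      ∃ x ∈ T.smallPrim m c, ∃ y ∈ T.smallPrim m c, x + y = z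
  · apply reduce
    have h1 := hG.le_of_pairs hpairs
    have h2 := Nat.mul_le_mul_right (∑ x ∈ T.smallApery m c, depth c m x)
      (show (T.smallPrim m c).card + 1 ≤ T.embeddingDim by omega)
    omega
  -- Otherwise every small element is primitive, and every decomposable one is a sum of two small
  -- primitives.
  obtain ⟨g, hgX, hgD⟩ : ∃ g ∈ T.smallApery m c, g ∈ T.decomp m c := by
    by_contra hcon
    push Not at hcon
    refine hpairs fun z hz => ?_
    obtain ⟨x, hx, y, hy, e⟩ := hG.split z hz
    refine ⟨x, ?_, y, ?_, e⟩
    · by_contra h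
      exact hcon x hx (hG.dec x hx h)
    · by_contra h
      exact hcon y hy (hG.dec y hy h)
  have large : ∀ a ∈ T.smallApery m c, m < a := by
    intro a ha
    simp only [smallApery, Finset.mem_filter, mem_apery hc] at ha
    refine lt_of_le_of_ne (hmdef ▸ multiplicity_le ha.1.1 ha.2.1) ?_
    rintro rfl
    exact not_isApery_self ha.1
  by_cases he : T.embeddingDim ≤ 3
  · refine le_mul_of_embeddingDim_le_three hmdef hc hF ?_ he
    have hPne : (T.smallPrim m c).Nonempty := by
      obtain ⟨x, hx, hmin⟩ := Finset.exists_min_image _ id ⟨g, hgX⟩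
      refine ⟨x, by_contra fun h => ?_⟩
      obtain ⟨a, ha, b, hb, rfl⟩ := hG.split x (hG.dec x hx h)
      have := hmin a ha
      have := hG.pos b hb
      simp only [id] at *
      omega
    have := Finset.card_pos.2 hPne
    omega
  -- The remaining goal `3 ≤ q` holds because `g = a + b > 2 * m` while `g < c`.
  · refine reduce (hG.le_of_card_bounds ?_ hgX hgD e2 (by omega) (by omega))
    obtain ⟨a, ha, b, hb, e⟩ := hG.split g hgD
    have := large a ha
    have := large b hb
    simp only [smallApery, Finset.mem_filter] at hgX
    by_contra hcon
    have := Nat.mul_le_mul_right m (show depth c m 0 ≤ 2 by omega)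
    omega

end Wilf

/-! ### Inheritance along the tree. -/

theorem IsChild.multiplicity_eq {A B : NumericalSemigroup} (h : B.IsChild A)
    (hm : (A.multiplicity : ℤ) < A.frobenius) : B.multiplicity = A.multiplicity := by
  obtain ⟨a, ⟨-, haR⟩, hBA⟩ := h
  have hmem : ∀ x, x ∈ B ↔ x ∈ A ∧ x ≠ a := fun x => by
    rw [← SetLike.mem_coe, hBA]; simp
  have haF := haR.2
  refine le_antisymm (multiplicity_le ((hmem _).2 ⟨A.multiplicity_mem, by omega⟩)
    A.multiplicity_pos.ne') ?_
  exact multiplicity_le ((hmem _).1 B.multiplicity_mem).1 B.multiplicity_pos.ne'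

theorem IsChild.primitives_inter_leftPart_subset {A B : NumericalSemigroup} (h : B.IsChild A) :
    A.primitives ∩ A.leftPart ⊆ B.primitives ∩ B.leftPart := by
  obtain ⟨a, ⟨-, haR⟩, hBA⟩ := h
  have hmem : ∀ x, x ∈ B ↔ x ∈ A ∧ x ≠ a := fun x => by
    rw [← SetLike.mem_coe, hBA]; simp
  have haF := haR.2
  -- The removed element is a new gap above the old Frobenius number, so left elements stay left.
  have hB : (a : ℤ) ≤ B.frobenius := B.frobenius_isGreatest.2 fun b hb e =>
    ((hmem b).1 hb).2 (by exact_mod_cast e)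
  rintro p ⟨hp, hpL⟩
  have hpF := hpL.2
  have hpB : p ∈ B := (hmem p).2 ⟨hp.1, by omega⟩
  exact ⟨⟨hpB, hp.2.1, fun x hx y hy => hp.2.2 x ((hmem x).1 hx).1 y ((hmem y).1 hy).1⟩,
    hpB, by omega⟩

/-- A surviving left primitive keeps the multiplicity below the Frobenius number, so no step can
remove it. -/
theorem IsDescendant.multiplicity_eq_and_subset {S T : NumericalSemigroup}
    (h : T.IsDescendant S) (hne : (S.primitives ∩ S.leftPart).Nonempty) :
    T.multiplicity = S.multiplicity ∧
      S.primitives ∩ S.leftPart ⊆ T.primitives ∩ T.leftPart := by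
  induction h with
  | refl => exact ⟨rfl, subset_rfl⟩
  | tail _ hchild ih =>
    refine ⟨(hchild.multiplicity_eq ?_).trans ih.1,
      ih.2.trans hchild.primitives_inter_leftPart_subset⟩
    obtain ⟨p, hp⟩ := hne
    obtain ⟨hp1, hp2⟩ := ih.2 hp
    have h1 := multiplicity_le hp1.1 hp1.2.1
    have h2 := hp2.2
    omega

end NumericalSemigroup

theorem mainTheorem4 (S : NumericalSemigroup)
    (hS : S ≠ NumericalSemigroup.ordinary S.multiplicity)
    (hel : (S.multiplicity : ℚ) / 3 ≤ (S.numLeftPrimitives : ℚ))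
    (T : NumericalSemigroup) (hT : T.IsDescendant S) :
    T.SatisfiesWilf := by
  have h3 : S.multiplicity ≤ 3 * S.numLeftPrimitives := by
    rw [div_le_iff₀ (by norm_num)] at hel
    have : (S.multiplicity : ℚ) ≤ ((3 * S.numLeftPrimitives : ℕ) : ℚ) := by
      push_cast
      linarith
    exact_mod_cast this
  have hne : (S.primitives ∩ S.leftPart).Nonempty := by
    rw [← Set.ncard_pos (S.primitives_finite.subset Set.inter_subset_left)]
    have := S.multiplicity_pos
    change 0 < S.numLeftPrimitives
    omega
  obtain ⟨h1, h2⟩ := hT.multiplicity_eq_and_subset hne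
  refine NumericalSemigroup.satisfiesWilf_of_le ?_
  rw [h1]
  refine h3.trans (Nat.mul_le_mul_left 3 ?_)
  exact Set.ncard_le_ncard h2 (T.primitives_finite.subset Set.inter_subset_left)
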